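/- For an infinite binary sequence $\omega=\omega_0\omega_1\omega_2\dots$ and natural numbers $k,n$ let $\omega([k,k+n))$ denote the string $\omega_k\omega_{k+1}\dots\omega_{k+n-1}$, and let $K(u)$ denote the (plain) Kolmogorov complexity of a binary string $u$, that is, the minimal length of a program producing $u$ on a fixed optimal machine. The sequence $\omega$ is called $\alpha$-everywhere complex if there is a constant $c$ such that $K(\omega([k,k+n)))\ge \alpha n-c$ for all natural numbers $k$ and $n$. Let $\alpha\in(0,1)$ be a real number. (1) For every computable probability measure $P$ on the Cantor space $\{0,1\}^{\mathbb N}$ there exists a sequence that is Martin-Löf random with respect to $P$ and is not $\alpha$-everywhere complex. (2) The mass problem "produce an $\alpha$-everywhere complex sequence" is not Medvedev (uniformly) reducible to the mass problem "produce a Martin-Löf random sequence": there is no single oracle machine that, for every sequence $X$ that is Martin-Löf random with respect to the uniform (fair coin) measure, given $X$ as oracle computes an $\alpha$-everywhere complex sequence. Here $P$ is computable if the measures $P(\{\omega : \omega \text{ extends } \sigma\})$ are computable reals uniformly in the binary string $\sigma$; $\omega$ is Martin-Löf random with respect to $P$ if $\omega\notin\bigcap_i U_i$ for every uniformly effectively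 open sequence $(U_i)_{i\in\mathbb N}$ with $P(U_i)\le 2^{-i}$ for all $i$. -/

import Mathlib

namespace EverywhereComplex

/-- The substring `ω_k ω_{k+1} … ω_{k+n-1}` of a binary sequence. -/
def substring (ω : ℕ → Bool) (k n : ℕ) : List Bool :=
  (List.range n).map fun i => ω (k + i)

/-! ### Kolmogorov complexity -/

/-- A universal machine on binary strings: the program `1^e 0 q` runs the `e`-th partial recursive
function on (the code of) `q` and decodes the result as a binary string. -/
def universalMachine (p : List Bool) : Part (List Bool) :=
  ((Denumerable.ofNat Nat.Partrec.Code (p.idxOf false)).eval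
    (Encodable.encode (p.drop (p.idxOf false + 1)))).bind
      fun m => ((Encodable.decode m : Option (List Bool)) : Part (List Bool))

theorem universalMachine_partrec : Partrec universalMachine := by
  have hidx : Primrec fun p : List Bool => p.idxOf false :=
    Primrec.list_idxOf.comp (Primrec.const false) Primrec.id
  have hcode : Computable fun p : List Bool =>
      Denumerable.ofNat Nat.Partrec.Code (p.idxOf false) :=
    ((Primrec.ofNat Nat.Partrec.Code).comp hidx).to_comp
  have harg : Computable fun p : List Bool =>
      Encodable.encode (p.drop (p.idxOf false + 1)) :=
    (Primrec.encode.comp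
      (Primrec.list_drop.comp (Primrec.succ.comp hidx) Primrec.id)).to_comp
  have hrun := Nat.Partrec.Code.eval_part.comp hcode harg
  have hdec : Partrec fun m : ℕ =>
      ((Encodable.decode m : Option (List Bool)) : Part (List Bool)) :=
    Computable.ofOption Computable.decode
  exact Partrec.bind hrun (hdec.comp Computable.snd).to₂

/-- The (plain) Kolmogorov complexity of a binary string: the minimal length of a program that
makes the universal machine produce it. -/
noncomputable def K (x : List Bool) : ℕ :=
  sInf {l : ℕ | ∃ p : List Bool, p.length = l ∧ x ∈ universalMachine p}

/-- The universal machine is optimal. -/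
theorem K_le_of_partrec (V : List Bool →. List Bool) (hV : Partrec V) :
    ∃ c : ℕ, ∀ p x : List Bool, x ∈ V p → K x ≤ p.length + c := by
  obtain ⟨C, hC⟩ := Nat.Partrec.Code.exists_code.1 hV
  refine ⟨Encodable.encode C + 1, fun p x hx => ?_⟩
  refine Nat.sInf_le ⟨List.replicate (Encodable.encode C) true ++ false :: p, ?_, ?_⟩
  · simp; omega
  · have h1 : (List.replicate (Encodable.encode C) true ++ false :: p).idxOf false
        = Encodable.encode C := by
      rw [List.idxOf_append_of_notMem (by simp)]
      simp
    have h2 : (List.replicate (Encodable.encode C) true ++ false :: p).drop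
        (Encodable.encode C + 1) = p := by
      rw [← List.drop_drop]
      simp
    simp only [universalMachine, h1, h2, Denumerable.ofNat_encode, hC]
    simp only [Encodable.encodek, Part.coe_some, Part.bind_some]
    exact Part.mem_bind (Part.mem_map _ hx) (by simp)

/-- Every string has a program, so that `K x` is the length of an actual shortest program. -/
theorem exists_program (x : List Bool) :
    ∃ p : List Bool, p.length = K x ∧ x ∈ universalMachine p := by
  refine Nat.sInf_mem (s := {l : ℕ | ∃ p : List Bool, p.length = l ∧ x ∈ universalMachine p}) ?_
  obtain ⟨C, hC⟩ := Nat.Partrec.Code.exists_code.1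
    (show Nat.Partrec fun _ => Part.some (Encodable.encode x) from
      Nat.Partrec.of_primrec (Nat.Primrec.const _))
  refine ⟨_, List.replicate (Encodable.encode C) true, rfl, ?_⟩
  have h1 : (List.replicate (Encodable.encode C) true).idxOf false = Encodable.encode C := by
    rw [List.idxOf_eq_length (by simp)]
    simp
  simp only [universalMachine, h1, Denumerable.ofNat_encode, hC]
  simp

/-- `ω` is `α`-everywhere complex. -/
def IsEverywhereComplex (α : ℝ) (ω : ℕ → Bool) : Prop :=
  ∃ c : ℝ, ∀ k n : ℕ, α * n - c ≤ K (substring ω k n)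

/-! ### Computable measures and Martin-Löf randomness on the Cantor space -/

/-- The set of infinite binary sequences that have `σ` as a prefix. -/
def cylinder (σ : List Bool) : Set (ℕ → Bool) :=
  {ω | substring ω 0 σ.length = σ}

/-- `P` is computable: the measures of the cylinders are computable reals, uniformly. -/
def IsComputableMeasure (P : MeasureTheory.Measure (ℕ → Bool)) : Prop :=
  ∃ f : List Bool → ℕ → ℕ, Computable₂ f ∧
    ∀ (σ : List Bool) (n : ℕ), |P.real (cylinder σ) - (f σ n : ℝ) / 2 ^ n| ≤ 1 / 2 ^ n

/-- The open set generated by the `i`-th section of a set of pairs (number, string). -/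
def testSet (S : ℕ × List Bool → Prop) (i : ℕ) : Set (ℕ → Bool) :=
  {ω | ∃ σ : List Bool, S (i, σ) ∧ ω ∈ cylinder σ}

/-- A Martin-Löf test for `P`: a uniformly effectively open sequence of sets, the `i`-th one of
measure at most `2^{-i}`. -/
def IsMartinLofTest (P : MeasureTheory.Measure (ℕ → Bool)) (S : ℕ × List Bool → Prop) : Prop :=
  REPred S ∧ ∀ i : ℕ, P (testSet S i) ≤ (2 ^ i)⁻¹

/-- `ω` is Martin-Löf random with respect to `P`: it passes all Martin-Löf tests for `P`. -/
def IsMartinLofRandom (P : MeasureTheory.Measure (ℕ → Bool)) (ω : ℕ → Bool) : Prop :=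
  ∀ S : ℕ × List Bool → Prop, IsMartinLofTest P S → ω ∉ ⋂ i : ℕ, testSet S i

/-- The uniform (fair coin) measure on the Cantor space. -/
noncomputable def fairCoin : MeasureTheory.Measure (ℕ → Bool) :=
  MeasureTheory.Measure.infinitePi fun _ : ℕ => (PMF.uniformOfFintype Bool).toMeasure

/-! ### Oracle machines and Medvedev reducibility -/

/-- The partial recursive functionals, that is, the maps `(X, n) ↦ Φ X n` computed by one oracle
machine with input `n` and with oracle `X`. The clauses are those of `Nat.RecursiveIn`, but here
the oracle is an argument, so that one derivation serves all oracles. -/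
inductive OracleComputable : ((ℕ → Bool) → ℕ →. ℕ) → Prop
  | zero : OracleComputable fun _ _ => Part.some 0
  | succ : OracleComputable fun _ n => Part.some (n + 1)
  | left : OracleComputable fun _ n => Part.some (Nat.unpair n).1
  | right : OracleComputable fun _ n => Part.some (Nat.unpair n).2
  | oracle : OracleComputable fun X n => Part.some (X n).toNat
  | pair {F G : (ℕ → Bool) → ℕ →. ℕ} (hF : OracleComputable F) (hG : OracleComputable G) :
      OracleComputable fun X n => Nat.pair <$> F X n <*> G X n
  | comp {F G : (ℕ → Bool) → ℕ →. ℕ} (hF : OracleComputable F) (hG : OracleComputable G) :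
      OracleComputable fun X n => G X n >>= F X
  | prec {F G : (ℕ → Bool) → ℕ →. ℕ} (hF : OracleComputable F) (hG : OracleComputable G) :
      OracleComputable fun X p =>
        let (a, n) := Nat.unpair p
        n.rec (F X a) fun y IH => do
          let i ← IH
          G X (Nat.pair a (Nat.pair y i))
  | rfind {F : (ℕ → Bool) → ℕ →. ℕ} (hF : OracleComputable F) :
      OracleComputable fun X a =>
        Nat.rfind fun n => (fun m => decide (m = 0)) <$> F X (Nat.pair a n)

/-- The mass problem `A` is Medvedev (uniformly) reducible to the mass problem `B`: a single oracle
machine transforms every element of `B` into an element of `A`. -/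
def MedvedevReducible (A B : Set (ℕ → Bool)) : Prop :=
  ∃ Φ : (ℕ → Bool) → ℕ →. ℕ, OracleComputable Φ ∧
    ∀ X ∈ B, ∃ Y ∈ A, ∀ n : ℕ, Φ X n = Part.some (Y n).toNat

end EverywhereComplex

/-! Fix `d` with `1/d ≤ α`. The core is measure-theoretic: for every probability measure `P` and
every `e` there is a finite list `F` such that `P`-most sequences contain an element of `F`, while
the element `x` at position `i` satisfies `2^(2e) (i+1) ≤ 2^⌊|x|/d⌋`
(`exists_sparse_measureReal_avoiding_le`). If `F` is computable from `e`, then `x` is described by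
`1^e 0` followed by its position written in `⌊|x|/d⌋ - 2e` bits, so `K x ≤ |x|/d - e + O(1)`. Hence
an `α`-everywhere complex sequence avoids `F e` for all large `e`, and such sequences have outer
measure at most `1/2`.

The list comes from lowering entropy. Suppose a sequence has at most `2^((k+1)n)` factors of length
`2dn`. Its factors of length `2dnt` are then words over a small alphabet of blocks, about
`2^((k+1)nt)` candidates for large `t`. Either at most `2^(knt)` of them occur, and the entropy has
dropped, or a random candidate occurs with probability about `2^(-nt)`; in that case about `2^(nt)`
greedily chosen candidates hit nearly all such sequences, whereas sparsity allows nearly `2^(2nt)`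
of them. After `2d` rounds only constant sequences are left, and these are hit by two more strings.

To find `F e` effectively it suffices to certify that sets have large measure (`IsSearchable`).
Computable measures allow this, and so do images of such measures under oracle machines
(`IsSearchable.map`). Random sequences have full measure, which gives (1). A Medvedev reduction
would push the fair coin to a searchable measure giving everywhere complex sequences outer measure
1, which gives (2). -/

namespace EverywhereComplex

open MeasureTheory Filter

/-! ### Substrings and blocks -/

theorem length_substring (ω : ℕ → Bool) (k n : ℕ) : (substring ω k n).length = n := by
  simp [substring]

theorem substring_add (ω : ℕ → Bool) (k m n : ℕ) :
    substring ω k (m + n) = substring ω k m ++ substring ω (k + m) n := by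
  simp [substring, List.range_add, Function.comp_def, Nat.add_assoc]

theorem substring_eq_iff {ω : ℕ → Bool} {k : ℕ} {x : List Bool} :
    substring ω k x.length = x ↔ ∀ i < x.length, ω (k + i) = x.getD i false := by
  constructor
  · intro h i hi
    conv_rhs => rw [← h]
    simp [substring, hi]
  · intro h
    refine List.ext_getElem (length_substring _ _ _) fun i h1 h2 => ?_
    rw [length_substring] at h1
    simpa [substring, h1] using h i h1

theorem drop_take_substring (ω : ℕ → Bool) {j m n : ℕ} (h : j + m ≤ n) :
    ((substring ω 0 n).drop j).take m = substring ω j m := by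
  obtain ⟨r, rfl⟩ := Nat.exists_eq_add_of_le h
  rw [substring_add, substring_add, List.append_assoc, List.drop_left' (length_substring _ _ _),
    List.take_left' (length_substring _ _ _), Nat.zero_add]

/-- The concatenations of `t` elements of `A`. -/
def blocks (A : Finset (List Bool)) : ℕ → Finset (List Bool)
  | 0 => {[]}
  | t + 1 => Finset.image₂ (· ++ ·) A (blocks A t)

theorem card_blocks_le (A : Finset (List Bool)) (t : ℕ) : (blocks A t).card ≤ A.card ^ t := by
  induction t with
  | zero => simp [blocks]
  | succ t ih =>
    rw [blocks, pow_succ']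
    exact (Finset.card_image₂_le _ _ _).trans (Nat.mul_le_mul_left _ ih)

theorem substring_mem_blocks {A : Finset (List Bool)} {ω : ℕ → Bool} {n : ℕ}
    (h : ∀ k, substring ω k n ∈ A) (t k : ℕ) : substring ω k (n * t) ∈ blocks A t := by
  induction t generalizing k with
  | zero => simp [blocks, substring]
  | succ t ih =>
    rw [Nat.mul_succ, Nat.add_comm (n * t), substring_add]
    exact Finset.mem_image₂_of_mem (f := (· ++ ·)) (h k) (ih _)

theorem length_of_mem_blocks {A : Finset (List Bool)} {n : ℕ} (h : ∀ x ∈ A, x.length = n) (t : ℕ) :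
    ∀ x ∈ blocks A t, x.length = n * t := by
  induction t with
  | zero => simp [blocks]
  | succ t ih =>
    intro x hx
    obtain ⟨a, ha, b, hb, rfl⟩ := Finset.mem_image₂.1 hx
    rw [List.length_append, h a ha, ih b hb]
    ring

/-- The strings of length `n`. -/
def strings (n : ℕ) : Finset (List Bool) := blocks {[false], [true]} n

theorem card_strings_le (n : ℕ) : (strings n).card ≤ 2 ^ n :=
  card_blocks_le _ n

theorem length_of_mem_strings {n : ℕ} {x : List Bool} (hx : x ∈ strings n) : x.length = n := by
  simpa using length_of_mem_blocks (n := 1) (by simp) n x hx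

theorem substring_mem_strings (ω : ℕ → Bool) (k n : ℕ) : substring ω k n ∈ strings n := by
  have := substring_mem_blocks (A := {[false], [true]}) (ω := ω) (n := 1)
    (fun k => by cases h : ω k <;> simp [substring, h]) n k
  rwa [Nat.one_mul] at this

/-! ### Occurrences -/

/-- The string `x` occurs in `ω`. -/
def Occurs (x : List Bool) (ω : ℕ → Bool) : Prop := ∃ k, substring ω k x.length = x

theorem occurs_substring (ω : ℕ → Bool) (k n : ℕ) : Occurs (substring ω k n) ω :=
  ⟨k, by rw [length_substring]⟩

theorem measurableSet_substring_eq (k : ℕ) (x : List Bool) :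
    MeasurableSet {ω : ℕ → Bool | substring ω k x.length = x} := by
  simp only [substring_eq_iff, Set.ofPred_forall]
  exact MeasurableSet.iInter fun i => MeasurableSet.iInter fun _ =>
    measurableSet_eq_fun (measurable_pi_apply (k + i)) measurable_const

theorem measurableSet_cylinder (σ : List Bool) : MeasurableSet (cylinder σ) :=
  measurableSet_substring_eq 0 σ

theorem measurableSet_occurs (x : List Bool) : MeasurableSet {ω | Occurs x ω} := by
  simp only [Occurs, Set.ofPred_exists]
  exact MeasurableSet.iUnion fun k => measurableSet_substring_eq k x

open Classical in
/-- The elements of `G` that occur in `ω`. -/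
noncomputable def occurring (G : Finset (List Bool)) (ω : ℕ → Bool) : Finset (List Bool) :=
  G.filter fun x => Occurs x ω

theorem mem_occurring {G : Finset (List Bool)} {ω : ℕ → Bool} {x : List Bool} :
    x ∈ occurring G ω ↔ x ∈ G ∧ Occurs x ω := by
  simp [occurring]

theorem card_occurring (G : Finset (List Bool)) (ω : ℕ → Bool) :
    (occurring G ω).card = ∑ x ∈ G, {ω | Occurs x ω}.indicator (fun _ => 1) ω := by
  classical
  rw [occurring, Finset.card_filter]
  refine Finset.sum_congr rfl fun x _ => ?_
  by_cases hx : Occurs x ω <;> simp [hx]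

theorem measurable_card_occurring (G : Finset (List Bool)) :
    Measurable fun ω => (occurring G ω).card := by
  simp only [card_occurring]
  exact Finset.measurable_fun_sum _ fun x _ => measurable_const.indicator (measurableSet_occurs x)

theorem measurableSet_lt_card_occurring (G : Finset (List Bool)) (q : ℕ) :
    MeasurableSet {ω | q < (occurring G ω).card} :=
  measurableSet_lt measurable_const (measurable_card_occurring G)

/-- The sequences in which no element of `F` occurs. -/
def avoiding (F : List (List Bool)) : Set (ℕ → Bool) := {ω | ∀ x ∈ F, ¬ Occurs x ω}

theorem measurableSet_avoiding (F : List (List Bool)) : MeasurableSet (avoiding F) := by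
  simp only [avoiding, Set.ofPred_forall]
  exact MeasurableSet.iInter fun x => MeasurableSet.iInter fun _ => (measurableSet_occurs x).compl

theorem avoiding_append (F F' : List (List Bool)) :
    avoiding (F ++ F') = avoiding F ∩ avoiding F' := by
  ext ω
  simp only [avoiding, List.mem_append, Set.mem_ofPred_eq, Set.mem_inter_iff]
  exact ⟨fun h => ⟨fun x hx => h x (.inl hx), fun x hx => h x (.inr hx)⟩,
    fun h x hx => hx.elim (h.1 x) (h.2 x)⟩

section

variable (P : Measure (ℕ → Bool)) [IsProbabilityMeasure P]

/-- Double counting: integrate the number of elements of `G` that occur in `ω` over `B`. -/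
theorem mul_measureReal_le_sum (G : Finset (List Bool)) (q : ℕ) {B : Set (ℕ → Bool)}
    (hB : MeasurableSet B) (hq : ∀ ω ∈ B, q ≤ (occurring G ω).card) :
    q * P.real B ≤ ∑ x ∈ G, P.real (B ∩ {ω | Occurs x ω}) := by
  have h : (q : ENNReal) * P B ≤ ∑ x ∈ G, P (B ∩ {ω | Occurs x ω}) := by
    calc (q : ENNReal) * P B = ∫⁻ _ in B, q ∂P := by simp
      _ ≤ ∫⁻ ω in B, ∑ x ∈ G, {ω | Occurs x ω}.indicator (fun _ => (1 : ENNReal)) ω ∂P := by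
        refine setLIntegral_mono' hB fun ω hω => ?_
        have := hq ω hω
        rw [card_occurring] at this
        calc (q : ENNReal) ≤ ((∑ x ∈ G, {ω | Occurs x ω}.indicator (fun _ => 1) ω : ℕ) : ENNReal) :=
              by exact_mod_cast this
          _ = _ := by
            push_cast
            refine Finset.sum_congr rfl fun x _ => ?_
            by_cases hx : ω ∈ {ω | Occurs x ω} <;> simp [hx]
      _ = ∑ x ∈ G, P (B ∩ {ω | Occurs x ω}) := by
        rw [lintegral_finsetSum _ fun x _ => measurable_const.indicator (measurableSet_occurs x)]
        refine Finset.sum_congr rfl fun x _ => ?_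
        rw [lintegral_indicator_const (measurableSet_occurs x), one_mul,
          Measure.restrict_apply (measurableSet_occurs x), Set.inter_comm]
  have h2 := ENNReal.toReal_mono (by simp) h
  rw [ENNReal.toReal_mul, ENNReal.toReal_sum (by simp)] at h2
  simpa [Measure.real] using h2

/-- By averaging, some element of `G` occurs in a fraction at least `q / M` of what is left of `B`.
Adding it to `F` shrinks the rest by the factor `1 - q/M ≤ exp (-q/M)`. -/
theorem exists_greedy {G : Finset (List Bool)} {q M : ℕ} (hq0 : 0 < q) (hM : G.card ≤ M) {B : Set (ℕ → Bool)}
    (hB : MeasurableSet B) (hq : ∀ ω ∈ B, q ≤ (occurring G ω).card) (R : ℕ) :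
    ∃ F : List (List Bool), F.length ≤ R ∧ (∀ x ∈ F, x ∈ G) ∧
      P.real (B ∩ avoiding F) ≤ Real.exp (-(q / M * R)) := by
  rcases G.eq_empty_or_nonempty with rfl | hG
  · refine ⟨[], by simp, by simp, ?_⟩
    have : B = ∅ := Set.eq_empty_of_forall_notMem fun ω hω => by
      have := hq ω hω
      simp [occurring] at this
      omega
    rw [this, Set.empty_inter, measureReal_empty]
    exact (Real.exp_pos _).le
  induction R with
  | zero => exact ⟨[], by simp, by simp, by simp⟩
  | succ R ih =>
    obtain ⟨F, hF, hFG, hFP⟩ := ih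
    have hM0 : (0 : ℝ) < M := by exact_mod_cast hG.card_pos.trans_le hM
    set B' := B ∩ avoiding F with hB'
    have hB'm : MeasurableSet B' := hB.inter (measurableSet_avoiding F)
    have hsum := mul_measureReal_le_sum P G q hB'm fun ω hω => hq ω hω.1
    obtain ⟨x, hx, hxP⟩ : ∃ x ∈ G, q / M * P.real B' ≤ P.real (B' ∩ {ω | Occurs x ω}) := by
      refine Finset.exists_le_of_sum_le hG ?_
      rw [Finset.sum_const, nsmul_eq_mul]
      calc (G.card : ℝ) * (q / M * P.real B') ≤ M * (q / M * P.real B') := by gcongr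
        _ = q * P.real B' := by field_simp
        _ ≤ _ := hsum
    refine ⟨F ++ [x], by simp [hF], ?_, ?_⟩
    · simp only [List.mem_append, List.mem_singleton]
      rintro y (hy | rfl)
      exacts [hFG y hy, hx]
    · have hset : B ∩ avoiding (F ++ [x]) = B' \ {ω | Occurs x ω} := by
        rw [avoiding_append, ← Set.inter_assoc, ← hB']
        ext ω
        simp [avoiding]
      have hdiff := measureReal_inter_add_sdiff (μ := P) (s := B') (measurableSet_occurs x)
      rw [hset]
      have h0 : 0 ≤ P.real B' := measureReal_nonneg
      have h1 := Real.add_one_le_exp (-(q / M : ℝ))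
      calc P.real (B' \ {ω | Occurs x ω}) ≤ (-(q / M : ℝ) + 1) * P.real B' := by linarith
        _ ≤ Real.exp (-(q / M : ℝ)) * Real.exp (-(q / M * R)) := by gcongr
        _ = _ := by
          rw [← Real.exp_add]
          congr 1
          push_cast
          ring

/-! ### Entropy reduction -/

/-- The position of every element of `F` is small compared with the length of the element. -/
def IsSparse (d e : ℕ) (F : List (List Bool)) : Prop :=
  ∀ i < F.length, 2 ^ (2 * e) * (i + 1) ≤ 2 ^ ((F.getD i []).length / d)

theorem IsSparse.append {d e : ℕ} {F F' : List (List Bool)} (hF : IsSparse d e F)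
    (h : ∀ x ∈ F', 2 ^ (2 * e) * (F.length + F'.length) ≤ 2 ^ (x.length / d)) :
    IsSparse d e (F ++ F') := by
  intro i hi
  rcases lt_or_ge i F.length with hlt | hge
  · rw [List.getD_append _ _ _ _ hlt]
    exact hF i hlt
  · rw [List.getD_append_right _ _ _ _ hge]
    rw [List.length_append] at hi
    have hi' : i - F.length < F'.length := by omega
    rw [List.getD_eq_getElem _ _ hi']
    exact (Nat.mul_le_mul_left _ hi).trans (h _ (List.getElem_mem _))

theorem add_mul_two_pow_le (a J m : ℕ) : a + J * 2 ^ m ≤ 2 ^ (a + J + m) := by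
  have h1 : 1 ≤ 2 ^ m := Nat.one_le_two_pow
  have h2 : a + J < 2 ^ (a + J) := Nat.lt_two_pow_self
  rw [pow_add _ (a + J) m]
  nlinarith

/-- The concatenations of `t` strings of length `n` that use at most `b` different strings. -/
def fewBlocks (n b t : ℕ) : Finset (List Bool) :=
  ((strings n).powerset.filter fun A => A.card ≤ b).biUnion fun A => blocks A t

/-- The first factor counts the possible alphabets; it does not depend on `t`, so it becomes
negligible for large `t`. -/
theorem card_fewBlocks_le (n b t : ℕ) : (fewBlocks n b t).card ≤ 2 ^ 2 ^ n * b ^ t := by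
  refine (Finset.card_biUnion_le_card_mul _ _ (b ^ t) fun A hA => ?_).trans ?_
  · exact (card_blocks_le A t).trans (Nat.pow_le_pow_left (Finset.mem_filter.1 hA).2 t)
  · refine Nat.mul_le_mul_right _ ((Finset.card_filter_le _ _).trans ?_)
    rw [Finset.card_powerset]
    exact Nat.pow_le_pow_right (by norm_num) (card_strings_le n)

theorem length_of_mem_fewBlocks {n b t : ℕ} {x : List Bool} (hx : x ∈ fewBlocks n b t) :
    x.length = n * t := by
  obtain ⟨A, hA, hx⟩ := Finset.mem_biUnion.1 hx
  refine length_of_mem_blocks (fun y hy => length_of_mem_strings ?_) t x hx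
  exact Finset.mem_powerset.1 (Finset.mem_filter.1 hA).1 hy

theorem occurring_strings_mul_subset {n b : ℕ} (t : ℕ) {ω : ℕ → Bool}
    (h : (occurring (strings n) ω).card ≤ b) :
    occurring (strings (n * t)) ω ⊆ occurring (fewBlocks n b t) ω := by
  intro x hx
  obtain ⟨hx, k, hk⟩ := mem_occurring.1 hx
  refine mem_occurring.2 ⟨Finset.mem_biUnion.2 ⟨occurring (strings n) ω, ?_, ?_⟩, k, hk⟩
  · refine Finset.mem_filter.2 ⟨Finset.mem_powerset.2 fun y hy => (mem_occurring.1 hy).1, h⟩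
  · rw [← hk, length_of_mem_strings hx]
    exact substring_mem_blocks (fun j => mem_occurring.2
      ⟨substring_mem_strings _ _ _, occurs_substring _ _ _⟩) t k

/-- One round of entropy reduction per step of the induction on `j`; each round spends half of the
permitted `ε`. -/
theorem exists_sparse_entropy_le {d : ℕ} (hd : 0 < d) (e : ℕ) (j : ℕ) (hj : j ≤ 2 * d) :
    ∀ ε : ℝ, 0 < ε → ∃ F : List (List Bool), IsSparse d e F ∧ ∃ n : ℕ, 0 < n ∧
      P.real (avoiding F ∩
        {ω | 2 ^ ((2 * d - j) * n) < (occurring (strings (2 * d * n)) ω).card}) ≤ ε := by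
  induction j with
  | zero =>
    intro ε hε
    refine ⟨[], by simp [IsSparse], 1, one_pos, ?_⟩
    have : {ω | 2 ^ ((2 * d - 0) * 1) < (occurring (strings (2 * d * 1)) ω).card} = ∅ := by
      refine Set.eq_empty_of_forall_notMem fun ω hω => absurd hω ?_
      rw [Set.mem_ofPred_eq, not_lt]
      refine (Finset.card_le_card fun x hx => (mem_occurring.1 hx).1).trans ?_
      simpa using card_strings_le (2 * d)
    rw [this]
    simp [hε.le]
  | succ j ih =>
    intro ε hε
    obtain ⟨F, hF, n, hn, hP⟩ := ih (by omega) (ε / 2) (half_pos hε)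
    obtain ⟨k, hk⟩ : ∃ k, 2 * d - j = k + 1 := ⟨2 * d - (j + 1), by omega⟩
    have hk' : 2 * d - (j + 1) = k := by omega
    rw [hk] at hP
    rw [hk']
    obtain ⟨J, hJ⟩ : ∃ J : ℕ, Real.exp (-(J : ℝ)) ≤ ε / 2 := by
      have := Real.tendsto_exp_neg_atTop_nhds_zero.comp tendsto_natCast_atTop_atTop
      obtain ⟨J, hJ⟩ := (this.eventually_lt_const (half_pos hε)).exists
      exact ⟨J, hJ.le⟩
    set C := 2 ^ (2 * d * n) with hC
    -- Sparsity of the new strings needs `2e + |F| + J + C + nt ≤ 2nt`, which this `t` ensures.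
    set t := F.length + J + C + 2 * e + 1 with ht
    set G := fewBlocks (2 * d * n) (2 ^ ((k + 1) * n)) t with hG
    set q := 2 ^ (k * (n * t)) with hq
    set R := J * 2 ^ (C + n * t) with hR
    set B := avoiding F ∩ ({ω | 2 ^ ((k + 1) * n) < (occurring (strings (2 * d * n)) ω).card}ᶜ ∩
      {ω | q < (occurring (strings (2 * d * (n * t))) ω).card}) with hB
    have hBm : MeasurableSet B := (measurableSet_avoiding F).inter
      ((measurableSet_lt_card_occurring _ _).compl.inter (measurableSet_lt_card_occurring _ _))
    have hGB : ∀ ω ∈ B, q ≤ (occurring G ω).card := by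
      rintro ω ⟨-, h1, h2⟩
      rw [Set.mem_compl_iff, Set.mem_ofPred_eq, not_lt] at h1
      rw [Set.mem_ofPred_eq, ← Nat.mul_assoc] at h2
      exact h2.le.trans (Finset.card_le_card (occurring_strings_mul_subset t h1))
    have hqpos : 0 < q := by positivity
    -- Hence `q / M = 2^-(C + nt)`, and `R` greedy choices leave measure at most `exp (-J)`.
    have hcard : G.card ≤ q * 2 ^ (C + n * t) := by
      refine (card_fewBlocks_le _ _ _).trans (le_of_eq ?_)
      rw [← hC, hq, ← pow_mul, ← pow_add, ← pow_add]
      congr 1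
      ring
    obtain ⟨F', hF'R, hF'G, hF'P⟩ := exists_greedy P hqpos hcard hBm hGB R
    refine ⟨F ++ F', hF.append fun x hx => ?_, n * t, by positivity, ?_⟩
    · have hx := length_of_mem_fewBlocks (hF'G x hx)
      have hxd : x.length / d = 2 * (n * t) := by
        rw [hx, show 2 * d * n * t = d * (2 * (n * t)) by ring, Nat.mul_div_cancel_left _ hd]
      have htn : t ≤ n * t := Nat.le_mul_of_pos_left t hn
      calc 2 ^ (2 * e) * (F.length + F'.length) ≤ 2 ^ (2 * e) * (F.length + R) := by gcongr
        _ ≤ 2 ^ (2 * e) * 2 ^ (F.length + J + (C + n * t)) := by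
          gcongr
          exact add_mul_two_pow_le _ _ _
        _ = 2 ^ (2 * e + (F.length + J + (C + n * t))) := (pow_add _ _ _).symm
        _ ≤ 2 ^ (x.length / d) := by
          rw [hxd]
          exact Nat.pow_le_pow_right (by norm_num) (by omega)
    · have hexp : P.real (B ∩ avoiding F') ≤ ε / 2 := by
        refine hF'P.trans (le_trans (Real.exp_le_exp.2 (neg_le_neg ?_)) hJ)
        have hq0 : (0 : ℝ) < q := by exact_mod_cast hqpos
        rw [hR]
        push_cast
        exact le_of_eq (by field_simp)
      calc _ ≤ P.real ((avoiding F ∩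
              {ω | 2 ^ ((k + 1) * n) < (occurring (strings (2 * d * n)) ω).card}) ∪
              (B ∩ avoiding F')) := by
            refine measureReal_mono ?_
            rw [avoiding_append]
            rintro ω ⟨⟨h1, h2⟩, h3⟩
            by_cases h4 : 2 ^ ((k + 1) * n) < (occurring (strings (2 * d * n)) ω).card
            · exact .inl ⟨h1, h4⟩
            · exact .inr ⟨⟨h1, h4, h3⟩, h2⟩
        _ ≤ _ := measureReal_union_le _ _
        _ ≤ ε := by linarith

theorem eq_of_card_occurring_le_one {n : ℕ} (hn : 0 < n) {ω : ℕ → Bool}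
    (h : (occurring (strings n) ω).card ≤ 1) (k : ℕ) : ω k = ω 0 := by
  have h1 : ∀ k, substring ω k n ∈ occurring (strings n) ω := fun k =>
    mem_occurring.2 ⟨substring_mem_strings _ _ _, occurs_substring _ _ _⟩
  have h2 := congrArg (fun l => l.getD 0 false) (Finset.card_le_one.1 h _ (h1 k) _ (h1 0))
  simpa [substring, hn] using h2

/-- For `j = 2d` the entropy bound allows a single factor, so the sequence is constant and contains
one of the two appended strings. -/
theorem exists_sparse_measureReal_avoiding_le {d : ℕ} (hd : 0 < d) (e : ℕ) :
    ∃ F : List (List Bool), IsSparse d e F ∧ P.real (avoiding F) ≤ 1 / 8 := by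
  obtain ⟨F, hF, n, hn, hP⟩ := exists_sparse_entropy_le P hd e (2 * d) le_rfl (1 / 8) (by norm_num)
  set m := d * (2 * e + F.length + 2) with hm
  refine ⟨F ++ [List.replicate m true, List.replicate m false], hF.append fun x hx => ?_,
    (measureReal_mono ?_).trans hP⟩
  · have hx : x.length = m := by
      simp only [List.mem_cons, List.not_mem_nil, or_false] at hx
      rcases hx with rfl | rfl <;> simp
    rw [hx, hm, Nat.mul_div_cancel_left _ hd, Nat.add_assoc, pow_add]
    exact Nat.mul_le_mul_left _ Nat.lt_two_pow_self.le
  · rw [avoiding_append]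
    rintro ω ⟨h1, h2⟩
    refine ⟨h1, ?_⟩
    by_contra h3
    simp only [Nat.sub_self, Nat.zero_mul, pow_zero, Set.mem_ofPred_eq, not_lt] at h3
    have h4 := eq_of_card_occurring_le_one (by positivity) h3
    have h5 : substring ω 0 m = List.replicate m (ω 0) := by
      rw [List.eq_replicate_iff]
      refine ⟨length_substring _ _ _, fun b hb => ?_⟩
      obtain ⟨i, -, rfl⟩ := List.mem_map.1 hb
      exact h4 _
    have h6 := occurs_substring ω 0 m
    rw [h5] at h6
    refine h2 _ ?_ h6
    cases ω 0 <;> simp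

end

/-! ### Searching for sets of large measure -/

/-- The open set generated by a list of strings. -/
def openSet (W : List (List Bool)) : Set (ℕ → Bool) := {ω | ∃ v ∈ W, ω ∈ cylinder v}

theorem openSet_eq (W : List (List Bool)) : openSet W = ⋃ v ∈ W.toFinset, cylinder v := by
  ext ω
  simp [openSet]

theorem measurableSet_openSet (W : List (List Bool)) : MeasurableSet (openSet W) := by
  rw [openSet_eq]
  exact Finset.measurableSet_biUnion _ fun v _ => measurableSet_cylinder v

theorem measureReal_openSet (P : Measure (ℕ → Bool)) [IsProbabilityMeasure P]
    {W : List (List Bool)} (hW : W.Nodup) {N : ℕ} (hN : ∀ v ∈ W, v.length = N) :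
    P.real (openSet W) = (W.map fun v => P.real (cylinder v)).sum := by
  rw [openSet_eq, measureReal_biUnion_finset, List.sum_toFinset _ hW]
  · intro v hv w hw hvw
    refine Set.disjoint_left.2 fun ω h1 h2 => hvw ?_
    have hv := hN v (by simpa using hv)
    have hw := hN w (by simpa using hw)
    simp only [cylinder, Set.mem_ofPred_eq] at h1 h2
    rw [← h1, ← h2, hv, hw]
  · exact fun v _ => measurableSet_cylinder v

/-- The open sets generated by finitely many strings of equal length that have measure greater than
`3/4` can be enumerated effectively, up to errors for sets of measure between `1/2` and `3/4`. -/
def IsSearchable (P : Measure (ℕ → Bool)) : Prop :=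
  ∃ g : List (List Bool) → ℕ → Bool, Computable₂ g ∧
    (∀ (W : List (List Bool)) (N : ℕ), W.Nodup → (∀ v ∈ W, v.length = N) →
      3 / 4 < P.real (openSet W) → ∃ s, g W s = true) ∧
    ∀ (W : List (List Bool)) (s : ℕ), g W s = true → 1 / 2 ≤ P.real (openSet W)

theorem nodup_iff_map_idxOf {α : Type*} [DecidableEq α] (l : List α) :
    l.Nodup ↔ (l.map fun a => l.idxOf a) = List.range l.length := by
  constructor
  · intro h
    refine List.ext_getElem (by simp) fun i h1 h2 => ?_
    simp [h.idxOf_getElem]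
  · intro h
    refine List.Nodup.of_map (fun a => l.idxOf a) ?_
    rw [h]
    exact List.nodup_range

theorem primrecPred_nodup {α : Type*} [Primcodable α] [DecidableEq α] :
    PrimrecPred fun l : List α => l.Nodup := by
  refine PrimrecPred.of_eq (p := fun l : List α => (l.map fun a => l.idxOf a) = List.range l.length)
    (Primrec.eq.comp ?_ (Primrec.list_range.comp Primrec.list_length)) fun l =>
      (nodup_iff_map_idxOf l).symm
  exact Primrec.list_map Primrec.id (Primrec.list_idxOf.comp Primrec.snd Primrec.fst).to₂

theorem primrecPred_length_eq {α : Type*} [Primcodable α] :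
    PrimrecPred fun W : List (List α) => ∀ v ∈ W, v.length = (W.getD 0 []).length := by
  have h : PrimrecRel fun (W : List (List α)) (n : ℕ) => ∀ v ∈ W, v.length = n :=
    PrimrecRel.forall_mem_list
      (Primrec.eq.comp (Primrec.list_length.comp Primrec.fst) Primrec.snd)
  exact h.comp Primrec.id
    (Primrec.list_length.comp ((Primrec.list_getD []).comp Primrec.id (Primrec.const 0)))

/-- Recursion on the index, so that `Computable.nat_rec` applies to an `f` that is merely
computable. -/
theorem sum_map_eq_rec {α : Type*} (f : α → ℕ) (d : α) (l : List α) :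
    (l.map f).sum = Nat.rec 0 (fun i s => s + f (l.getD i d)) l.length := by
  have h : ∀ n, (Nat.rec 0 (fun i s => s + f (l.getD i d)) n : ℕ) =
      ∑ i ∈ Finset.range n, f (l.getD i d) := by
    intro n
    induction n with
    | zero => rfl
    | succ n ih => rw [Finset.sum_range_succ, ← ih]
  rw [h]
  clear h
  induction l with
  | nil => rfl
  | cons a l ih =>
    rw [List.length_cons, Finset.sum_range_succ', List.map_cons, List.sum_cons, ih, add_comm]
    simp

theorem computable_sum_map {f : List Bool → ℕ → ℕ} (hf : Computable₂ f) :
    Computable₂ fun (W : List (List Bool)) (m : ℕ) => (W.map fun v => f v m).sum := by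
  have h : Computable fun p : List (List Bool) × ℕ =>
      (Nat.rec 0 (fun i s => s + f (p.1.getD i []) p.2) p.1.length : ℕ) := by
    refine Computable.nat_rec (h := fun (p : List (List Bool) × ℕ) (q : ℕ × ℕ) =>
      q.2 + f (p.1.getD q.1 []) p.2) (Computable.list_length.comp Computable.fst)
      (Computable.const 0) (Primrec.nat_add.to_comp.comp (Computable.snd.comp Computable.snd) ?_)
    exact hf.comp ((Primrec.list_getD []).to_comp.comp (Computable.fst.comp Computable.fst)
      (Computable.fst.comp Computable.snd)) (Computable.snd.comp Computable.fst)
  exact h.of_eq fun p => (sum_map_eq_rec (fun v => f v p.2) [] p.1).symm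

theorem abs_sum_map_sub_le {α : Type*} (f g : α → ℝ) {δ : ℝ} (l : List α)
    (h : ∀ a ∈ l, |f a - g a| ≤ δ) : |(l.map f).sum - (l.map g).sum| ≤ l.length * δ := by
  induction l with
  | nil => simp
  | cons a l ih =>
    have h1 := abs_le.1 (h a (by simp))
    have h2 := abs_le.1 (ih fun b hb => h b (by simp [hb]))
    simp only [List.map_cons, List.sum_cons, List.length_cons]
    push_cast
    rw [abs_le]
    constructor <;> linarith [h1.1, h1.2, h2.1, h2.2]

theorem primrec_two_pow : Primrec fun n : ℕ => 2 ^ n :=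
  (Primrec.nat_rec₁ (f := fun _ s => 2 * s) 1
    (Primrec.nat_mul.comp (Primrec.const 2) Primrec.snd)).of_eq fun n => by
      induction n with
      | zero => rfl
      | succ n ih => rw [pow_succ', ← ih]

theorem IsComputableMeasure.isSearchable {P : Measure (ℕ → Bool)} [IsProbabilityMeasure P]
    (hP : IsComputableMeasure P) : IsSearchable P := by
  classical
  obtain ⟨f, hf, hfP⟩ := hP
  -- With `|W| + 3` bits of precision the total error is at most `|W| / 2^(|W|+3) ≤ 1/8`. The
  -- threshold `5/8` used below therefore separates `3/4` from `1/2`.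
  let S : List (List Bool) → ℕ := fun W => (W.map fun v => f v (W.length + 3)).sum
  have hS : Computable S := (computable_sum_map hf).comp Computable.id
    (Primrec.nat_add.to_comp.comp Computable.list_length (Computable.const 3))
  have key : ∀ W : List (List Bool), W.Nodup → ∀ N, (∀ v ∈ W, v.length = N) →
      |P.real (openSet W) - (S W : ℝ) / 2 ^ (W.length + 3)| ≤ 1 / 8 := by
    intro W hW N hN
    rw [measureReal_openSet P hW hN]
    have h1 := abs_sum_map_sub_le (fun v => P.real (cylinder v))
      (fun v => (f v (W.length + 3) : ℝ) / 2 ^ (W.length + 3)) W fun v _ => hfP v _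
    have h2 : (W.map fun v => (f v (W.length + 3) : ℝ) / 2 ^ (W.length + 3)).sum
        = (S W : ℝ) / 2 ^ (W.length + 3) := by
      have : ∀ (L : List (List Bool)) (m : ℕ), (L.map fun v => (f v m : ℝ) / 2 ^ m).sum
          = ((L.map fun v => f v m).sum : ℝ) / 2 ^ m := by
        intro L m
        induction L with
        | nil => simp
        | cons a L ih =>
          simp only [List.map_cons, List.sum_cons, ih]
          push_cast
          ring
      exact this W _
    rw [h2] at h1
    refine h1.trans ?_
    have h3 : (W.length : ℝ) ≤ 2 ^ W.length := by exact_mod_cast Nat.lt_two_pow_self.le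
    rw [pow_add, mul_one_div, div_le_iff₀ (by positivity)]
    linarith
  refine ⟨fun W _ => (decide W.Nodup && decide (∀ v ∈ W, v.length = (W.getD 0 []).length)) &&
    decide (5 * 2 ^ (W.length + 3) ≤ 8 * S W), ?_, ?_, ?_⟩
  · have h1 : Computable fun W : List (List Bool) =>
        (decide W.Nodup && decide (∀ v ∈ W, v.length = (W.getD 0 []).length)) :=
      (Primrec.and.comp primrecPred_nodup.decide primrecPred_length_eq.decide).to_comp
    have h2 : Computable fun W : List (List Bool) =>
        decide (5 * 2 ^ (W.length + 3) ≤ 8 * S W) :=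
      Primrec.nat_le.decide.to_comp.comp
        (Primrec.nat_mul.comp (Primrec.const 5) (primrec_two_pow.comp
          (Primrec.nat_add.comp Primrec.list_length (Primrec.const 3)))).to_comp
        (Primrec.nat_mul.to_comp.comp (Computable.const 8) hS)
    exact (Primrec.and.to_comp.comp h1 h2).comp Computable.fst
  · intro W N hW hN h
    have h1 := (abs_le.1 (key W hW N hN)).2
    refine ⟨0, ?_⟩
    simp only [Bool.and_eq_true, decide_eq_true_eq]
    refine ⟨⟨hW, fun v hv => ?_⟩, ?_⟩
    · cases W with
      | nil => simp at hv
      | cons a W =>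
        rw [hN v hv]
        simp [hN a]
    · have h2 : (5 / 8 : ℝ) ≤ (S W : ℝ) / 2 ^ (W.length + 3) := by linarith
      rw [le_div_iff₀ (by positivity)] at h2
      have h3 : (5 : ℝ) * 2 ^ (W.length + 3) ≤ 8 * S W := by linarith
      exact_mod_cast h3
  · intro W s h
    simp only [Bool.and_eq_true, decide_eq_true_eq] at h
    obtain ⟨⟨hW, hN⟩, h⟩ := h
    have h1 := (abs_le.1 (key W hW _ hN)).1
    have h2 : (5 : ℝ) * 2 ^ (W.length + 3) ≤ 8 * S W := by exact_mod_cast h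
    have h3 : (5 / 8 : ℝ) ≤ (S W : ℝ) / 2 ^ (W.length + 3) := by
      rw [le_div_iff₀ (by positivity)]
      linarith
    linarith

/-! ### A computable sequence of sparse sets -/

/-- Every string in `W` has a substring in `F`. -/
def Hits (F W : List (List Bool)) : Prop :=
  ∀ v ∈ W, ∃ x ∈ F, ∃ k < v.length + 1, (v.drop k).take x.length = x

theorem primrecRel_exists_lt {α : Type*} [Primcodable α] {R : ℕ → α → Prop}
    (hR : PrimrecRel R) : PrimrecRel fun n a => ∃ k < n, R k a :=
  (hR.exists_mem_list.comp (Primrec.list_range.comp Primrec.fst) Primrec.snd).of_eq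
    fun _ => by simp

theorem primrecRel_forall_lt {α : Type*} [Primcodable α] {R : ℕ → α → Prop}
    (hR : PrimrecRel R) : PrimrecRel fun n a => ∀ k < n, R k a :=
  (hR.forall_mem_list.comp (Primrec.list_range.comp Primrec.fst) Primrec.snd).of_eq
    fun _ => by simp

theorem primrecRel_hits : PrimrecRel Hits := by
  have h1 : PrimrecRel fun (k : ℕ) (y : List Bool × List Bool) =>
      (y.1.drop k).take y.2.length = y.2 :=
    Primrec.eq.comp
      (Primrec.list_take.comp (Primrec.list_length.comp (Primrec.snd.comp Primrec.snd))
        (Primrec.list_drop.comp Primrec.fst (Primrec.fst.comp Primrec.snd)))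
      (Primrec.snd.comp Primrec.snd)
  have h2 : PrimrecRel fun (x v : List Bool) =>
      ∃ k < v.length + 1, (v.drop k).take x.length = x :=
    PrimrecRel.comp (primrecRel_exists_lt h1) (Primrec.succ.comp (Primrec.list_length.comp Primrec.snd))
      (Primrec.pair Primrec.snd Primrec.fst)
  exact h2.exists_mem_list.swap.forall_mem_list.swap

theorem primrecRel_isSparse (d : ℕ) : PrimrecRel (IsSparse d) := by
  unfold IsSparse
  have h1 : PrimrecRel fun (i : ℕ) (y : ℕ × List (List Bool)) =>
      2 ^ (2 * y.1) * (i + 1) ≤ 2 ^ ((y.2.getD i []).length / d) := by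
    refine Primrec.nat_le.comp (Primrec.nat_mul.comp (primrec_two_pow.comp
      (Primrec.nat_mul.comp (Primrec.const 2) (Primrec.fst.comp Primrec.snd)))
      (Primrec.succ.comp Primrec.fst)) (primrec_two_pow.comp ?_)
    exact Primrec.nat_div.comp (Primrec.list_length.comp ((Primrec.list_getD []).comp
      (Primrec.snd.comp Primrec.snd) Primrec.fst)) (Primrec.const d)
  exact PrimrecRel.comp (primrecRel_forall_lt h1) (Primrec.list_length.comp Primrec.snd) Primrec.id

theorem Hits.openSet_subset {F W : List (List Bool)} (h : Hits F W) :
    openSet W ⊆ (avoiding F)ᶜ := by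
  rintro ω ⟨v, hv, hω⟩ hF
  obtain ⟨x, hx, k, hk, hxk⟩ := h v hv
  refine hF x hx ⟨k, ?_⟩
  -- Together with `k ≤ |v|` this shows that the occurrence ends inside `v`; that bound on `k`
  -- matters when `x` is empty.
  have hl := congrArg List.length hxk
  rw [List.length_take, List.length_drop] at hl
  rw [← drop_take_substring ω (n := v.length) (by omega)]
  simp only [cylinder, Set.mem_ofPred_eq] at hω
  rw [hω, hxk]

/-- Continuity from below: an occurrence is visible in a finite prefix, so prefixes of some length
`N` already witness measure above `3/4 < 7/8`. -/
theorem exists_hits (P : Measure (ℕ → Bool)) [IsProbabilityMeasure P] {F : List (List Bool)}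
    (hF : P.real (avoiding F) ≤ 1 / 8) :
    ∃ (W : List (List Bool)) (N : ℕ), W.Nodup ∧ (∀ v ∈ W, v.length = N) ∧ Hits F W ∧
      3 / 4 < P.real (openSet W) := by
  classical
  let H : ℕ → Set (ℕ → Bool) := fun N =>
    {ω | ∃ x ∈ F, ∃ k, k + x.length ≤ N ∧ substring ω k x.length = x}
  have hmono : Monotone H := by
    rintro M N hMN ω ⟨x, hx, k, hk, h⟩
    exact ⟨x, hx, k, hk.trans hMN, h⟩
  have hunion : (avoiding F)ᶜ = ⋃ N, H N := by
    ext ω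
    simp only [avoiding, Set.mem_compl_iff, Set.mem_ofPred_eq, Set.mem_iUnion, H]
    push Not
    constructor
    · rintro ⟨x, hx, k, hk⟩
      exact ⟨k + x.length, x, hx, k, le_rfl, hk⟩
    · rintro ⟨N, x, hx, k, -, hk⟩
      exact ⟨x, hx, k, hk⟩
  have hlim : Tendsto (fun N => P.real (H N)) atTop (nhds (P.real (avoiding F)ᶜ)) := by
    rw [hunion]
    exact (ENNReal.tendsto_toReal (by simp)).comp (tendsto_measure_iUnion_atTop hmono)
  have hc : 3 / 4 < P.real (avoiding F)ᶜ := by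
    rw [probReal_compl_eq_one_sub (measurableSet_avoiding F)]
    linarith
  obtain ⟨N, hN⟩ := (hlim.eventually_const_lt hc).exists
  refine ⟨((strings N).filter fun v => Hits F [v]).toList, N, Finset.nodup_toList _,
    fun v hv => ?_, fun v hv => ?_, hN.trans_le (measureReal_mono ?_)⟩
  · rw [Finset.mem_toList, Finset.mem_filter] at hv
    exact length_of_mem_strings hv.1
  · rw [Finset.mem_toList, Finset.mem_filter] at hv
    exact hv.2 v (by simp)
  · rintro ω ⟨x, hx, k, hk, h⟩
    refine ⟨substring ω 0 N, ?_, ?_⟩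
    · rw [Finset.mem_toList, Finset.mem_filter]
      refine ⟨substring_mem_strings _ _ _, fun v hv => ⟨x, hx, k, ?_, ?_⟩⟩
      · rw [List.mem_singleton.1 hv, length_substring]
        omega
      · rw [List.mem_singleton.1 hv, drop_take_substring ω hk, h]
    · simp [cylinder, length_substring]

theorem exists_computable_surjective (α : Type*) [Primcodable α] [Inhabited α] :
    ∃ f : ℕ → α, Computable f ∧ Function.Surjective f :=
  ⟨fun n => (Encodable.decode n).getD default,
    Computable.option_getD Computable.decode (Computable.const _),
    fun a => ⟨Encodable.encode a, by simp⟩⟩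

/-- Unbounded search for a list together with a certificate (`W` and a stage) that it is hit with
probability at least `1/2`. The bound `1/8` proved above guarantees that the search ends. -/
theorem IsSearchable.exists_computable {P : Measure (ℕ → Bool)} [IsProbabilityMeasure P]
    (hP : IsSearchable P) {d : ℕ} (hd : 0 < d) :
    ∃ F : ℕ → List (List Bool), Computable F ∧
      ∀ e, IsSparse d e (F e) ∧ P.real (avoiding (F e)) ≤ 1 / 2 := by
  classical
  obtain ⟨g, hg, hg1, hg2⟩ := hP
  obtain ⟨dec, hdec, hsurj⟩ :=
    exists_computable_surjective (List (List Bool) × List (List Bool) × ℕ)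
  let Q : ℕ → ℕ → Prop := fun e n =>
    (IsSparse d e (dec n).1 ∧ Hits (dec n).1 (dec n).2.1) ∧ g (dec n).2.1 (dec n).2.2 = true
  have hQ : ComputablePred fun p : ℕ × ℕ => Q p.1 p.2 := by
    refine ComputablePred.computable_iff.2 ⟨fun p =>
      (decide (IsSparse d p.1 (dec p.2).1) && decide (Hits (dec p.2).1 (dec p.2).2.1)) &&
        g (dec p.2).2.1 (dec p.2).2.2, ?_, by ext p; simp [Q]⟩
    have hd2 : Computable fun p : ℕ × ℕ => dec p.2 := hdec.comp Computable.snd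
    have hd21 := Computable.fst.comp (Computable.snd.comp hd2)
    refine Primrec.and.to_comp.comp (Primrec.and.to_comp.comp ?_ ?_)
      (hg.comp hd21 (Computable.snd.comp (Computable.snd.comp hd2)))
    · exact (primrecRel_isSparse d).decide.to_comp.comp Computable.fst (Computable.fst.comp hd2)
    · exact primrecRel_hits.decide.to_comp.comp (Computable.fst.comp hd2) hd21
  have hex : ∀ e, ∃ n, Q e n := by
    intro e
    obtain ⟨F, hF, hFP⟩ := exists_sparse_measureReal_avoiding_le P hd e
    obtain ⟨W, N, hW, hN, hH, hWP⟩ := exists_hits P hFP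
    obtain ⟨s, hs⟩ := hg1 W N hW hN hWP
    obtain ⟨n, hn⟩ := hsurj (F, W, s)
    exact ⟨n, by simpa [Q, hn] using ⟨⟨hF, hH⟩, hs⟩⟩
  refine ⟨fun e => (dec (Nat.find (hex e))).1,
    Computable.fst.comp (hdec.comp (Computable.find hQ hex)), fun e => ?_⟩
  obtain ⟨⟨h1, h2⟩, h3⟩ := Nat.find_spec (hex e)
  refine ⟨h1, ?_⟩
  have h4 := (hg2 _ _ h3).trans (measureReal_mono h2.openSet_subset)
  rw [probReal_compl_eq_one_sub (measurableSet_avoiding _)] at h4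
  linarith

/-! ### Everywhere complex sequences avoid sparse sets -/

/-- The value of a string as a binary numeral, the least significant digit first. -/
def value (q : List Bool) : ℕ := q.foldr (fun b n => 2 * n + b.toNat) 0

theorem primrec_value : Primrec value :=
  Primrec.list_foldr Primrec.id (Primrec.const 0)
    (Primrec.nat_add.comp
      (Primrec.nat_mul.comp (Primrec.const 2) (Primrec.snd.comp Primrec.snd))
      ((Primrec.dom_bool Bool.toNat).comp (Primrec.fst.comp Primrec.snd))).to₂

theorem exists_value_eq {l i : ℕ} (hi : i < 2 ^ l) : ∃ q : List Bool, q.length = l ∧ value q = i := by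
  induction l generalizing i with
  | zero => exact ⟨[], rfl, by rw [pow_zero] at hi; simp [value]; omega⟩
  | succ l ih =>
    obtain ⟨q, hq, hv⟩ := ih (i := i / 2) (by rw [pow_succ] at hi; omega)
    refine ⟨decide (i % 2 = 1) :: q, by simp [hq], ?_⟩
    have : value (decide (i % 2 = 1) :: q) = 2 * value q + (decide (i % 2 = 1)).toNat := rfl
    rw [this, hv]
    rcases Nat.mod_two_eq_zero_or_one i with h | h <;> simp [h] <;> omega

/-- Coding `e` in unary costs `e + 1` bits, while the factor `2^(2e)` in `IsSparse` saves `2e` bits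
on the position; the net gain is `e` up to a constant. -/
theorem exists_K_le_of_isSparse {F : ℕ → List (List Bool)} (hF : Computable F) {d : ℕ}
    (hS : ∀ e, IsSparse d e (F e)) :
    ∃ c : ℕ, ∀ e, ∀ x ∈ F e, K x + e ≤ x.length / d + c := by
  let V : List Bool →. List Bool := fun p =>
    ((F (p.idxOf false))[value (p.drop (p.idxOf false + 1))]? : Option (List Bool))
  have hV : Partrec V := by
    have hidx : Primrec fun p : List Bool => p.idxOf false :=
      Primrec.list_idxOf.comp (Primrec.const false) Primrec.id
    exact Computable.ofOption (Computable.list_getElem?.comp (hF.comp hidx.to_comp)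
      (primrec_value.comp (Primrec.list_drop.comp (Primrec.succ.comp hidx) Primrec.id)).to_comp)
  obtain ⟨c, hc⟩ := K_le_of_partrec V hV
  refine ⟨c + 1, fun e x hx => ?_⟩
  obtain ⟨i, hi, rfl⟩ := List.mem_iff_getElem.1 hx
  set x := (F e)[i] with hxdef
  have h := hS e i hi
  rw [List.getD_eq_getElem _ _ hi, ← hxdef] at h
  have h2 : 2 * e ≤ x.length / d := by
    refine (Nat.pow_le_pow_iff_right (a := 2) (by norm_num)).1 (le_trans ?_ h)
    exact Nat.le_mul_of_pos_right _ (by omega)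
  obtain ⟨r, hr⟩ := Nat.exists_eq_add_of_le h2
  rw [hr, pow_add] at h
  have h3 : i < 2 ^ r := Nat.le_of_mul_le_mul_left h (by positivity)
  obtain ⟨q, hq, hv⟩ := exists_value_eq h3
  have h4 := hc (List.replicate e true ++ false :: q) x ?_
  · simp only [List.length_append, List.length_replicate, List.length_cons, hq] at h4
    omega
  · have h5 : (List.replicate e true ++ false :: q).idxOf false = e := by
      rw [List.idxOf_append_of_notMem (by simp)]
      simp
    have h6 : (List.replicate e true ++ false :: q).drop (e + 1) = q := by
      rw [← List.drop_drop]
      simp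
    simp only [V, h5, h6, hv]
    simp [hi, hxdef]

theorem IsEverywhereComplex.eventually_mem_avoiding {α : ℝ} {ω : ℕ → Bool}
    (hω : IsEverywhereComplex α ω) {d : ℕ} (hα : 1 / (d : ℝ) ≤ α)
    {F : ℕ → List (List Bool)} (hF : Computable F) (hS : ∀ e, IsSparse d e (F e)) :
    ∃ e₀, ∀ e ≥ e₀, ω ∈ avoiding (F e) := by
  obtain ⟨c₁, h1⟩ := hω
  obtain ⟨c₂, h2⟩ := exists_K_le_of_isSparse hF hS
  obtain ⟨e₀, he₀⟩ := exists_nat_gt (c₁ + c₂)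
  refine ⟨e₀, fun e he x hx ⟨k, hk⟩ => ?_⟩
  have h3 := h1 k x.length
  rw [hk] at h3
  have h4 : (K x : ℝ) + e ≤ (x.length / d : ℕ) + c₂ := by exact_mod_cast h2 e x hx
  have h5 : ((x.length / d : ℕ) : ℝ) ≤ α * x.length := by
    refine Nat.cast_div_le.trans ?_
    rw [div_eq_mul_one_div, mul_comm]
    gcongr
  have h6 : (e₀ : ℝ) ≤ e := by exact_mod_cast he
  linarith

theorem IsSearchable.measure_isEverywhereComplex_le {P : Measure (ℕ → Bool)}
    [IsProbabilityMeasure P] (hP : IsSearchable P) {α : ℝ} (hα : 0 < α) :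
    P {ω | IsEverywhereComplex α ω} ≤ 1 / 2 := by
  obtain ⟨d, hd⟩ := exists_nat_one_div_lt hα
  obtain ⟨F, hF, h⟩ := hP.exists_computable d.succ_pos
  let A : ℕ → Set (ℕ → Bool) := fun e₀ => {ω | ∀ e ≥ e₀, ω ∈ avoiding (F e)}
  have hA : Monotone A := fun a b hab ω hω e he => hω e (hab.trans he)
  calc P {ω | IsEverywhereComplex α ω} ≤ P (⋃ e₀, A e₀) := by
        refine measure_mono fun ω hω => Set.mem_iUnion.2 ?_
        refine IsEverywhereComplex.eventually_mem_avoiding hω (d := d + 1) ?_ hF fun e => (h e).1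
        push_cast
        exact hd.le
    _ = ⨆ e₀, P (A e₀) := hA.measure_iUnion
    _ ≤ 1 / 2 := by
        refine iSup_le fun e₀ => ?_
        have h1 : P (A e₀) ≤ P (avoiding (F e₀)) := measure_mono fun ω hω => hω e₀ le_rfl
        refine h1.trans ?_
        rw [← ofReal_measureReal]
        refine (ENNReal.ofReal_le_ofReal (h e₀).2).trans ?_
        rw [ENNReal.ofReal_div_of_pos (by norm_num)]
        simp

/-! ### Almost every sequence is random -/

theorem exists_code_of_rePred {α : Type*} [Primcodable α] {S : α → Prop} (hS : REPred S) :
    ∃ c : Nat.Partrec.Code, ∀ a, S a ↔ (c.eval (Encodable.encode a)).Dom := by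
  obtain ⟨c, hc⟩ := Nat.Partrec.Code.exists_code.1 hS
  refine ⟨c, fun a => ?_⟩
  rw [hc]
  simp [Part.assert]

/-- There are only countably many tests, one code for each, and every test captures a null set. -/
theorem measure_not_isMartinLofRandom (P : Measure (ℕ → Bool)) :
    P {ω | ¬ IsMartinLofRandom P ω} = 0 := by
  let S : Nat.Partrec.Code → ℕ × List Bool → Prop := fun c a => (c.eval (Encodable.encode a)).Dom
  have hsub : {ω | ¬ IsMartinLofRandom P ω} ⊆
      ⋃ c : {c : Nat.Partrec.Code // IsMartinLofTest P (S c)}, ⋂ i, testSet (S c) i := by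
    intro ω hω
    simp only [IsMartinLofRandom, Set.mem_ofPred_eq] at hω
    push Not at hω
    obtain ⟨T, hT, hωT⟩ := hω
    obtain ⟨c, hc⟩ := exists_code_of_rePred hT.1
    obtain rfl : T = S c := funext fun a => propext (hc a)
    exact Set.mem_iUnion.2 ⟨⟨c, hT⟩, hωT⟩
  refine measure_mono_null hsub (measure_iUnion_null fun ⟨c, hc⟩ => ?_)
  refine le_antisymm (ge_of_tendsto' (x := atTop) (f := fun i : ℕ => ((2 : ENNReal) ^ i)⁻¹) ?_
    fun i => (measure_mono (Set.iInter_subset _ i)).trans (hc.2 i)) zero_le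
  simp only [ENNReal.inv_pow]
  exact ENNReal.tendsto_pow_atTop_nhds_zero_of_lt_one (by simp)

theorem exists_isMartinLofRandom_not_isEverywhereComplex {P : Measure (ℕ → Bool)}
    [IsProbabilityMeasure P] (hP : IsComputableMeasure P) {α : ℝ} (hα : 0 < α) :
    ∃ ω, IsMartinLofRandom P ω ∧ ¬ IsEverywhereComplex α ω := by
  by_contra! h
  have h1 : (Set.univ : Set (ℕ → Bool)) ⊆
      {ω | ¬ IsMartinLofRandom P ω} ∪ {ω | IsEverywhereComplex α ω} := fun ω _ => by
    by_cases hω : IsMartinLofRandom P ω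
    · exact .inr (h ω hω)
    · exact .inl hω
  have h2 := (measure_mono (μ := P) h1).trans (measure_union_le _ _)
  rw [measure_univ, measure_not_isMartinLofRandom, zero_add] at h2
  have h3 := h2.trans (hP.isSearchable.measure_isEverywhereComplex_le hα)
  norm_num at h3

/-! ### The fair coin measure -/

instance : IsProbabilityMeasure fairCoin := by
  unfold fairCoin
  infer_instance

theorem fairCoin_cylinder (σ : List Bool) : fairCoin.real (cylinder σ) = 1 / 2 ^ σ.length := by
  have h : cylinder σ =
      Set.pi (Finset.range σ.length) fun i => ({σ.getD i false} : Set Bool) := by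
    ext ω
    simp only [cylinder, Set.mem_ofPred_eq, substring_eq_iff]
    simp [Set.mem_pi]
  rw [h, Measure.real, fairCoin, Measure.infinitePi_pi _ fun _ _ => measurableSet_singleton _]
  simp

theorem isComputableMeasure_fairCoin : IsComputableMeasure fairCoin := by
  refine ⟨fun σ n => 2 ^ n / 2 ^ σ.length, ?_, fun σ n => ?_⟩
  · exact (Primrec.nat_div.comp (primrec_two_pow.comp Primrec.snd)
      (primrec_two_pow.comp (Primrec.list_length.comp Primrec.fst))).to_comp
  · rw [fairCoin_cylinder]
    have h1 : ((2 ^ n / 2 ^ σ.length : ℕ) : ℝ) ≤ 2 ^ n / 2 ^ σ.length := by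
      exact_mod_cast Nat.cast_div_le (α := ℝ) (m := 2 ^ n) (n := 2 ^ σ.length)
    have h2 : (2 ^ n / 2 ^ σ.length : ℝ) < ((2 ^ n / 2 ^ σ.length : ℕ) : ℝ) + 1 := by
      rw [div_lt_iff₀ (by positivity)]
      exact_mod_cast (mul_comm (2 ^ σ.length) _) ▸ Nat.lt_mul_div_succ (2 ^ n) (Nat.two_pow_pos σ.length)
    have h3 : (1 / 2 ^ σ.length : ℝ) = (2 ^ n / 2 ^ σ.length) / 2 ^ n := by field_simp
    rw [h3, ← sub_div, abs_div, abs_of_nonneg (sub_nonneg.2 h1), abs_of_pos (by positivity)]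
    gcongr
    linarith

/-! ### Oracle machines with finite oracles -/

/-- The partial function `φ` with finite oracles approximates the functional `Φ`. -/
def Approximates (φ : List Bool → ℕ →. ℕ) (Φ : (ℕ → Bool) → ℕ →. ℕ) : Prop :=
  ∀ X n y, (y ∈ Φ X n → ∀ᶠ L in atTop, y ∈ φ (substring X 0 L) n) ∧
    ∀ L, y ∈ φ (substring X 0 L) n → y ∈ Φ X n

theorem approximates_const (f : ℕ →. ℕ) : Approximates (fun _ => f) fun _ => f :=
  fun _ _ _ => ⟨fun h => Eventually.of_forall fun _ => h, fun _ h => h⟩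

theorem approximates_oracle :
    Approximates (fun τ n => ((τ[n]?.map Bool.toNat : Option ℕ) : Part ℕ))
      fun X n => Part.some (X n).toNat := by
  intro X n y
  simp only [Part.mem_some_iff, Part.mem_coe, Option.mem_def, Option.map_eq_some_iff]
  constructor
  · rintro rfl
    filter_upwards [eventually_gt_atTop n] with L hL
    exact ⟨X n, by simp [substring, hL], rfl⟩
  · rintro L ⟨b, hb, rfl⟩
    obtain ⟨h1, rfl⟩ := List.getElem?_eq_some_iff.1 hb
    simp [substring]

theorem Approximates.pair {φ γ : List Bool → ℕ →. ℕ} {F G : (ℕ → Bool) → ℕ →. ℕ}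
    (hF : Approximates φ F) (hG : Approximates γ G) :
    Approximates (fun τ n => (φ τ n).bind fun i => (γ τ n).map (Nat.pair i))
      fun X n => Nat.pair <$> F X n <*> G X n := by
  intro X n y
  have h : Nat.pair <$> F X n <*> G X n = (F X n).bind fun i => (G X n).map (Nat.pair i) :=
    Part.ext fun y => by simp [Seq.seq]
  simp only [h, Part.mem_bind_iff, Part.mem_map_iff]
  constructor
  · rintro ⟨i, hi, j, hj, rfl⟩
    filter_upwards [(hF X _ i).1 hi, (hG X _ j).1 hj] with L h1 h2
    exact ⟨i, h1, j, h2, rfl⟩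
  · rintro L ⟨i, hi, j, hj, rfl⟩
    exact ⟨i, (hF X _ i).2 L hi, j, (hG X _ j).2 L hj, rfl⟩

theorem Approximates.comp {φ γ : List Bool → ℕ →. ℕ} {F G : (ℕ → Bool) → ℕ →. ℕ}
    (hF : Approximates φ F) (hG : Approximates γ G) :
    Approximates (fun τ n => (γ τ n).bind (φ τ)) fun X n => G X n >>= F X := by
  refine fun X n y => ⟨fun hy => ?_, fun L hy => ?_⟩
  · obtain ⟨i, hi, hy⟩ := Part.mem_bind_iff.1 hy
    filter_upwards [(hG X n i).1 hi, (hF X i y).1 hy] with L h1 h2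
    exact Part.mem_bind h1 h2
  · obtain ⟨i, hi, hy⟩ := Part.mem_bind_iff.1 hy
    exact Part.mem_bind ((hG X n i).2 L hi) ((hF X i y).2 L hy)

theorem Approximates.prec {φ γ : List Bool → ℕ →. ℕ} {F G : (ℕ → Bool) → ℕ →. ℕ}
    (hF : Approximates φ F) (hG : Approximates γ G) :
    Approximates (fun τ p => (Nat.unpair p).2.rec (φ τ (Nat.unpair p).1) fun y IH =>
        IH.bind fun i => γ τ (Nat.pair (Nat.unpair p).1 (Nat.pair y i)))
      fun X p => (Nat.unpair p).2.rec (F X (Nat.unpair p).1) fun y IH =>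
        IH.bind fun i => G X (Nat.pair (Nat.unpair p).1 (Nat.pair y i)) := by
  intro X p y
  simp only
  generalize (Nat.unpair p).2 = n
  induction n generalizing y with
  | zero => exact hF X _ y
  | succ n ih =>
    simp only [Part.mem_bind_iff]
    constructor
    · rintro ⟨i, hi, hy⟩
      filter_upwards [(ih i).1 hi, (hG X _ y).1 hy] with L h1 h2
      exact ⟨i, h1, h2⟩
    · rintro L ⟨i, hi, hy⟩
      exact ⟨i, (ih i).2 L hi, (hG X _ y).2 L hy⟩

theorem Approximates.rfind {φ : List Bool → ℕ →. ℕ} {F : (ℕ → Bool) → ℕ →. ℕ}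
    (hF : Approximates φ F) :
    Approximates
      (fun τ a => Nat.rfind fun n => (φ τ (Nat.pair a n)).map fun m => decide (m = 0))
      fun X a => Nat.rfind fun n => (F X (Nat.pair a n)).map fun m => decide (m = 0) := by
  intro X a y
  constructor
  · intro hy
    obtain ⟨h0, h⟩ := Nat.mem_rfind.1 hy
    have h2 : ∀ᶠ L in atTop, ∀ m ∈ Finset.range y,
        false ∈ (φ (substring X 0 L) (Nat.pair a m)).map fun m => decide (m = 0) := by
      refine (eventually_all_finset _).2 fun m hm => ?_
      obtain ⟨j, hj, hj0⟩ := (Part.mem_map_iff _).1 (h (Finset.mem_range.1 hm))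
      filter_upwards [(hF X _ j).1 hj] with L h1
      exact (Part.mem_map_iff _).2 ⟨j, h1, hj0⟩
    obtain ⟨i, hi, hi0⟩ := (Part.mem_map_iff _).1 h0
    filter_upwards [(hF X _ i).1 hi, h2] with L h1 h2
    exact Nat.mem_rfind.2 ⟨(Part.mem_map_iff _).2 ⟨i, h1, hi0⟩,
      fun hm => h2 _ (Finset.mem_range.2 hm)⟩
  · intro L hy
    obtain ⟨h0, h⟩ := Nat.mem_rfind.1 hy
    obtain ⟨i, hi, hi0⟩ := (Part.mem_map_iff _).1 h0
    refine Nat.mem_rfind.2 ⟨(Part.mem_map_iff _).2 ⟨i, (hF X _ i).2 L hi, hi0⟩, fun hm => ?_⟩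
    obtain ⟨j, hj, hj0⟩ := (Part.mem_map_iff _).1 (h hm)
    exact (Part.mem_map_iff _).2 ⟨j, (hF X _ j).2 L hj, hj0⟩

/-- The use principle: a halting computation queries finitely many bits, and a finite oracle gives
no answer beyond its end. -/
theorem OracleComputable.exists_approximates {Φ : (ℕ → Bool) → ℕ →. ℕ}
    (hΦ : OracleComputable Φ) : ∃ φ, Partrec₂ φ ∧ Approximates φ Φ := by
  induction hΦ with
  | zero => exact ⟨_, (Computable.const 0).partrec.to₂, approximates_const _⟩
  | succ =>
    exact ⟨_, (Primrec.succ.comp Primrec.snd).to_comp.partrec.to₂, approximates_const _⟩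
  | left =>
    exact ⟨_, (Primrec.fst.comp (Primrec.unpair.comp Primrec.snd)).to_comp.partrec.to₂,
      approximates_const _⟩
  | right =>
    exact ⟨_, (Primrec.snd.comp (Primrec.unpair.comp Primrec.snd)).to_comp.partrec.to₂,
      approximates_const _⟩
  | oracle =>
    refine ⟨_, ?_, approximates_oracle⟩
    exact Computable.ofOption (Primrec.option_map
      (Primrec.list_getElem?.comp Primrec.fst Primrec.snd)
      ((Primrec.dom_bool Bool.toNat).comp Primrec.snd).to₂).to_comp
  | @pair F G _ _ ihF ihG =>
    obtain ⟨φ, hφ, hφF⟩ := ihF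
    obtain ⟨γ, hγ, hγG⟩ := ihG
    refine ⟨_, ?_, hφF.pair hγG⟩
    refine Partrec.bind (hφ.comp Computable.fst Computable.snd) (Partrec.map
      (hγ.comp (Computable.fst.comp Computable.fst) (Computable.snd.comp Computable.fst)) ?_)
    exact (Primrec₂.natPair.comp (Primrec.snd.comp Primrec.fst) Primrec.snd).to_comp.to₂
  | @comp F G _ _ ihF ihG =>
    obtain ⟨φ, hφ, hφF⟩ := ihF
    obtain ⟨γ, hγ, hγG⟩ := ihG
    refine ⟨_, ?_, hφF.comp hγG⟩
    exact Partrec.bind (hγ.comp Computable.fst Computable.snd)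
      (hφ.comp (Computable.fst.comp Computable.fst) Computable.snd).to₂
  | @prec F G _ _ ihF ihG =>
    obtain ⟨φ, hφ, hφF⟩ := ihF
    obtain ⟨γ, hγ, hγG⟩ := ihG
    refine ⟨_, ?_, hφF.prec hγG⟩
    have hu : Computable fun p : List Bool × ℕ => Nat.unpair p.2 :=
      Computable.unpair.comp Computable.snd
    refine Partrec.nat_rec (f := fun p : List Bool × ℕ => (Nat.unpair p.2).2)
      (g := fun p => φ p.1 (Nat.unpair p.2).1)
      (h := fun p q => γ p.1 (Nat.pair (Nat.unpair p.2).1 (Nat.pair q.1 q.2)))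
      (Computable.snd.comp hu) (hφ.comp Computable.fst (Computable.fst.comp hu)) ?_
    refine hγ.comp (Computable.fst.comp Computable.fst) ?_
    exact Primrec₂.natPair.to_comp.comp (Computable.fst.comp (hu.comp Computable.fst))
      (Primrec₂.natPair.to_comp.comp (Computable.fst.comp Computable.snd)
        (Computable.snd.comp Computable.snd))
  | @rfind F _ ihF =>
    obtain ⟨φ, hφ, hφF⟩ := ihF
    refine ⟨_, ?_, hφF.rfind⟩
    refine Partrec.rfind (p := fun (p : List Bool × ℕ) n =>
      (φ p.1 (Nat.pair p.2 n)).map fun m => decide (m = 0)) (Partrec.map (hφ.comp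
        (Computable.fst.comp Computable.fst)
        (Primrec₂.natPair.to_comp.comp (Computable.snd.comp Computable.fst) Computable.snd)) ?_)
    exact (Primrec.eq.decide.comp Primrec.snd (Primrec.const 0)).to_comp.to₂

theorem Partrec₂.exists_code {φ : List Bool → ℕ →. ℕ} (hφ : Partrec₂ φ) :
    ∃ c : Nat.Partrec.Code, ∀ τ n y, y ∈ φ τ n ↔
      ∀ᶠ s in atTop, c.evaln s (Encodable.encode (τ, n)) = some y := by
  obtain ⟨c, hc⟩ := Nat.Partrec.Code.exists_code.1 hφ
  refine ⟨c, fun τ n y => ?_⟩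
  have h1 : y ∈ φ τ n ↔ y ∈ c.eval (Encodable.encode (τ, n)) := by
    rw [hc]
    simp
  rw [h1]
  constructor
  · intro h
    obtain ⟨s, hs⟩ := Nat.Partrec.Code.evaln_complete.1 h
    filter_upwards [eventually_ge_atTop s] with s' hs'
    exact Nat.Partrec.Code.evaln_mono hs' hs
  · intro h
    obtain ⟨s, hs⟩ := h.exists
    exact Nat.Partrec.Code.evaln_sound hs

/-! ### Images of measures under oracle machines -/

/-- With every oracle in `T` the machine `c` computes, within `s` steps, an element of `W`. -/
def Computes (c : Nat.Partrec.Code) (s : ℕ) (T W : List (List Bool)) : Prop :=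
  ∀ τ ∈ T, ∃ v ∈ W, ∀ j < v.length,
    c.evaln s (Encodable.encode (τ, j)) = some (v.getD j false).toNat

theorem primrecPred_computes (c : Nat.Partrec.Code) :
    PrimrecPred fun p : ℕ × List (List Bool) × List (List Bool) => Computes c p.1 p.2.1 p.2.2 := by
  unfold Computes
  have h1 : PrimrecRel fun (j : ℕ) (y : List Bool × List Bool × ℕ) =>
      c.evaln y.2.2 (Encodable.encode (y.2.1, j)) = some (y.1.getD j false).toNat := by
    refine Primrec.eq.comp (Nat.Partrec.Code.primrec_evaln.comp (Primrec.pair (Primrec.pair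
      (Primrec.snd.comp (Primrec.snd.comp Primrec.snd)) (Primrec.const c)) (Primrec.encode.comp
      (Primrec.pair (Primrec.fst.comp (Primrec.snd.comp Primrec.snd)) Primrec.fst)))) ?_
    exact Primrec.option_some.comp ((Primrec.dom_bool Bool.toNat).comp
      ((Primrec.list_getD false).comp (Primrec.fst.comp Primrec.snd) Primrec.fst))
  have h2 : PrimrecRel fun (v : List Bool) (y : List Bool × ℕ) => ∀ j < v.length,
      c.evaln y.2 (Encodable.encode (y.1, j)) = some (v.getD j false).toNat :=
    PrimrecRel.comp (primrecRel_forall_lt h1) (Primrec.list_length.comp Primrec.fst) Primrec.id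
  have h3 : PrimrecRel fun (τ : List Bool) (y : ℕ × List (List Bool)) => ∃ v ∈ y.2,
      ∀ j < v.length, c.evaln y.1 (Encodable.encode (τ, j)) = some (v.getD j false).toNat :=
    PrimrecRel.comp h2.exists_mem_list (Primrec.snd.comp Primrec.snd)
      (Primrec.pair Primrec.fst (Primrec.fst.comp Primrec.snd))
  exact PrimrecRel.comp h3.forall_mem_list (Primrec.fst.comp Primrec.snd)
    (Primrec.pair Primrec.fst (Primrec.snd.comp Primrec.snd))

theorem mem_cylinder_iff {ω : ℕ → Bool} {v : List Bool} :
    ω ∈ cylinder v ↔ ∀ j < v.length, ω j = v.getD j false := by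
  simp [cylinder, substring_eq_iff]

theorem toNat_injective : Function.Injective Bool.toNat := by decide

/-- Certificates pull back: a stage codes a list `T` of oracle prefixes, a stage certifying that `T`
is large for `μ`, and a number of steps within which the machine sends every prefix in `T` into `W`.
-/
theorem IsSearchable.map {μ : Measure (ℕ → Bool)} [IsProbabilityMeasure μ] (hμ : IsSearchable μ)
    {Φ : (ℕ → Bool) → ℕ →. ℕ} (hΦ : OracleComputable Φ) {G : (ℕ → Bool) → ℕ → Bool}
    (hG : Measurable G) (hGΦ : ∀ᵐ X ∂μ, ∀ n, Φ X n = Part.some (G X n).toNat) :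
    IsSearchable (μ.map G) := by
  classical
  obtain ⟨φ, hφ, hφΦ⟩ := hΦ.exists_approximates
  obtain ⟨c, hc⟩ := Partrec₂.exists_code hφ
  obtain ⟨g, hg, hg1, hg2⟩ := hμ
  have hmap : ∀ W, (μ.map G).real (openSet W) = μ.real (G ⁻¹' openSet W) := fun W =>
    map_measureReal_apply hG (measurableSet_openSet W)
  obtain ⟨dec, hdec, hsurj⟩ := exists_computable_surjective (List (List Bool) × ℕ × ℕ)
  refine ⟨fun W n => g (dec n).1 (dec n).2.1 && decide (Computes c (dec n).2.2 (dec n).1 W),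
    ?_, ?_, ?_⟩
  · have h2 : Computable fun p : List (List Bool) × ℕ => dec p.2 := hdec.comp Computable.snd
    refine Primrec.and.to_comp.comp (hg.comp (Computable.fst.comp h2)
      (Computable.fst.comp (Computable.snd.comp h2))) ?_
    have h3 : Computable fun p : List (List Bool) × ℕ => ((dec p.2).2.2, (dec p.2).1, p.1) :=
      (Computable.snd.comp (Computable.snd.comp h2)).pair
        ((Computable.fst.comp h2).pair Computable.fst)
    exact (primrecPred_computes c).decide.to_comp.comp h3
  · intro W N hW hN h
    rw [hmap] at h
    let E : List Bool → Prop := fun τ => ∃ v ∈ W, ∀ j < v.length, (v.getD j false).toNat ∈ φ τ j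
    -- `Approximates` does not assert monotonicity in the prefix; quantifying over all longer
    -- prefixes makes `A` increasing.
    let A : ℕ → Set (ℕ → Bool) := fun L => {X | ∀ L' ≥ L, E (substring X 0 L')}
    have hA : Monotone A := fun a b hab X hX L hL => hX L (hab.trans hL)
    have hsub : G ⁻¹' openSet W ≤ᵐ[μ] ⋃ L, A L := by
      filter_upwards [hGΦ] with X hX hXW
      obtain ⟨v, hv, hvX⟩ := hXW
      rw [mem_cylinder_iff] at hvX
      have h1 : ∀ᶠ L in atTop, ∀ j ∈ Finset.range v.length,
          (v.getD j false).toNat ∈ φ (substring X 0 L) j := by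
        refine (eventually_all_finset _).2 fun j hj => (hφΦ X j _).1 ?_
        rw [hX j, hvX j (Finset.mem_range.1 hj)]
        exact Part.mem_some _
      obtain ⟨L, hL⟩ := eventually_atTop.1 h1
      exact Set.mem_iUnion.2 ⟨L, fun L' hL' => ⟨v, hv, fun j hj =>
        hL L' hL' j (Finset.mem_range.2 hj)⟩⟩
    have hlim : Tendsto (fun L => μ.real (A L)) atTop (nhds (μ.real (⋃ L, A L))) :=
      (ENNReal.tendsto_toReal (by simp)).comp (tendsto_measure_iUnion_atTop hA)
    have hlt : 3 / 4 < μ.real (⋃ L, A L) :=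
      h.trans_le (ENNReal.toReal_mono (by simp) (measure_mono_ae hsub))
    obtain ⟨L, hL⟩ := (hlim.eventually_const_lt hlt).exists
    let T := ((strings L).filter E).toList
    have hT : ∀ τ ∈ T, τ.length = L ∧ E τ := fun τ hτ => by
      rw [Finset.mem_toList, Finset.mem_filter] at hτ
      exact ⟨length_of_mem_strings hτ.1, hτ.2⟩
    have hAT : A L ⊆ openSet T := by
      intro X hX
      refine ⟨substring X 0 L, ?_, by simp [cylinder, length_substring]⟩
      rw [Finset.mem_toList, Finset.mem_filter]
      exact ⟨substring_mem_strings _ _ _, hX L le_rfl⟩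
    obtain ⟨s, hs⟩ := hg1 T L (Finset.nodup_toList _) (fun τ hτ => (hT τ hτ).1)
      (hL.trans_le (measureReal_mono hAT))
    have hev : ∀ᶠ r in atTop, ∀ τ ∈ T.toFinset, ∃ v ∈ W, ∀ j < v.length,
        c.evaln r (Encodable.encode (τ, j)) = some (v.getD j false).toNat := by
      refine (eventually_all_finset _).2 fun τ hτ => ?_
      obtain ⟨v, hv, hvj⟩ := (hT τ (List.mem_toFinset.1 hτ)).2
      have h1 : ∀ᶠ r in atTop, ∀ j ∈ Finset.range v.length,
          c.evaln r (Encodable.encode (τ, j)) = some (v.getD j false).toNat :=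
        (eventually_all_finset _).2 fun j hj => (hc τ j _).1 (hvj j (Finset.mem_range.1 hj))
      filter_upwards [h1] with r hr
      exact ⟨v, hv, fun j hj => hr j (Finset.mem_range.2 hj)⟩
    obtain ⟨r, hr⟩ := hev.exists
    obtain ⟨n, hn⟩ := hsurj (T, s, r)
    refine ⟨n, ?_⟩
    simp only [hn, Bool.and_eq_true, decide_eq_true_eq]
    exact ⟨hs, fun τ hτ => hr τ (List.mem_toFinset.2 hτ)⟩
  · intro W n h
    rw [Bool.and_eq_true, decide_eq_true_eq] at h
    obtain ⟨h1, h2⟩ := h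
    rw [hmap]
    refine (hg2 _ _ h1).trans (ENNReal.toReal_mono (by simp) (measure_mono_ae ?_))
    filter_upwards [hGΦ] with X hX ⟨τ, hτ, hXτ⟩
    obtain ⟨v, hv, hvj⟩ := h2 τ hτ
    refine ⟨v, hv, mem_cylinder_iff.2 fun j hj => toNat_injective ?_⟩
    simp only [cylinder, Set.mem_ofPred_eq] at hXτ
    have h3 : (v.getD j false).toNat ∈ φ τ j := by
      refine (hc τ j _).2 ?_
      filter_upwards [eventually_ge_atTop (dec n).2.2] with s hs
      exact Nat.Partrec.Code.evaln_mono hs (hvj j hj)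
    rw [← hXτ] at h3
    have h4 := (hφΦ X j _).2 _ h3
    rw [hX j, Part.mem_some_iff] at h4
    exact h4.symm

theorem OracleComputable.measurableSet_mem {Φ : (ℕ → Bool) → ℕ →. ℕ} (hΦ : OracleComputable Φ)
    (n y : ℕ) : MeasurableSet {X | y ∈ Φ X n} := by
  obtain ⟨φ, -, hφ⟩ := hΦ.exists_approximates
  have h : {X | y ∈ Φ X n} = ⋃ τ ∈ {τ | y ∈ φ τ n}, cylinder τ := by
    ext X
    simp only [Set.mem_ofPred_eq, Set.mem_iUnion, exists_prop]
    constructor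
    · intro hX
      obtain ⟨L, hL⟩ := ((hφ X n y).1 hX).exists
      exact ⟨_, hL, by simp [cylinder, length_substring]⟩
    · rintro ⟨τ, hτ, hX⟩
      simp only [cylinder, Set.mem_ofPred_eq] at hX
      rw [← hX] at hτ
      exact (hφ X n y).2 _ hτ
  rw [h]
  exact MeasurableSet.biUnion (Set.to_countable _) fun τ _ => measurableSet_cylinder τ

theorem not_medvedevReducible {α : ℝ} (hα : 0 < α) :
    ¬ MedvedevReducible {ω | IsEverywhereComplex α ω} {ω | IsMartinLofRandom fairCoin ω} := by
  classical
  rintro ⟨Φ, hΦ, h⟩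
  -- A total measurable version of `Φ`, with value `false` where `Φ` diverges; it agrees with `Φ` on
  -- random oracles.
  let G : (ℕ → Bool) → ℕ → Bool := fun X n => decide (1 ∈ Φ X n)
  have hG : Measurable G := by
    refine measurable_pi_iff.2 fun n => measurable_to_bool ?_
    have : (fun X => G X n) ⁻¹' {true} = {X | 1 ∈ Φ X n} := by
      ext X
      simp [G]
    rw [this]
    exact hΦ.measurableSet_mem n 1
  have hY : ∀ X, IsMartinLofRandom fairCoin X →
      IsEverywhereComplex α (G X) ∧ ∀ n, Φ X n = Part.some (G X n).toNat := by
    intro X hX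
    obtain ⟨Y, hY, hΦY⟩ := h X hX
    obtain rfl : G X = Y := by
      funext n
      simp only [G, hΦY n, Part.mem_some_iff]
      cases Y n <;> simp
    exact ⟨hY, hΦY⟩
  have hae : ∀ᵐ X ∂fairCoin, IsMartinLofRandom fairCoin X :=
    measure_not_isMartinLofRandom fairCoin
  have hs := isComputableMeasure_fairCoin.isSearchable.map hΦ hG (hae.mono fun X hX => (hY X hX).2)
  have : IsProbabilityMeasure (fairCoin.map G) := Measure.isProbabilityMeasure_map hG.aemeasurable
  -- This inequality holds for arbitrary sets, so measurability of the set of complex sequences is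
  -- not needed.
  have h1 := (Measure.le_map_apply hG.aemeasurable _).trans (hs.measure_isEverywhereComplex_le hα)
  have h2 : fairCoin (G ⁻¹' {ω | IsEverywhereComplex α ω}) = 1 := by
    rw [measure_eq_measure_of_null_sdiff (Set.subset_univ _), measure_univ]
    exact measure_mono_null (fun X hX hX' => hX.2 (hY X hX').1) hae
  rw [h2] at h1
  norm_num at h1

end EverywhereComplex

theorem mainTheorem7 (α : ℝ) (hα : α ∈ Set.Ioo (0 : ℝ) 1) :
    (∀ P : MeasureTheory.Measure (ℕ → Bool), MeasureTheory.IsProbabilityMeasure P →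
      EverywhereComplex.IsComputableMeasure P →
      ∃ ω : ℕ → Bool, EverywhereComplex.IsMartinLofRandom P ω ∧
        ¬ EverywhereComplex.IsEverywhereComplex α ω) ∧
    ¬ EverywhereComplex.MedvedevReducible
      {ω | EverywhereComplex.IsEverywhereComplex α ω}
      {ω | EverywhereComplex.IsMartinLofRandom EverywhereComplex.fairCoin ω} :=
  ⟨fun _ _ hP => EverywhereComplex.exists_isMartinLofRandom_not_isEverywhereComplex hP hα.1,
    EverywhereComplex.not_medvedevReducible hα.1⟩
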